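/- Let $n\ge 1$, let $\mathbb B$ be the open unit ball and $\mathbb S$ the unit sphere of $\mathbb R^n$, and let $dx'$ be the surface measure on $\mathbb S$, normalized so that $r^{n-1}\,dr\,dx'$ is the Lebesgue measure on $\mathbb B$ scaled to total mass one. For a (real- or complex-valued) harmonic function $f$ on $\mathbb B$ put $M_1(f,r)=\int_{\mathbb S}|f(rx')|\,dx'$, $0\le r<1$. For $\alpha>0$ and $0<p<\infty$ let $B^{\infty,1}_\alpha$ and $B^{p,1}_\alpha$ be the spaces of harmonic functions $f$ on $\mathbb B$ for which, respectively, $$\|f\|_{B^{\infty,1}_\alpha}=\sup_{0\le r<1}M_1(f,r)(1-r)^\alpha<\infty,\qquad \|f\|_{B^{p,1}_\alpha}=\left(\int_0^1M_1(f,r)^p(1-r)^{\alpha p-1}\,dr\right)^{1/p}<\infty .$$ For $\varepsilon>0$ let $L_{\varepsilon,\alpha}(f)=\{r\in[0,1):(1-r)^\alpha\int_{\mathbb S}|f(rx')|\,dx'\ge\varepsilon\}$. **Theorem.** Let $1\le p<\infty$ and $\alpha>0$. For $f\in B^{\infty,1}_\alpha$ set $$s_1(f)=\operatorname{dist}_{B^{\infty,1}_\alpha}(f,B^{p,1}_\alpha)=\inf_{g\in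 B^{p,1}_\alpha}\|f-g\|_{B^{\infty,1}_\alpha},\qquad s_2(f)=\inf\left\{\varepsilon>0:\int_{L_{\varepsilon,\alpha}(f)}\frac{dr}{1-r}<\infty\right\}.$$ Then $s_1(f)\asymp s_2(f)$: there are finite constants $C_1,C_2\ge 0$, depending only on $p$, $\alpha$ and $n$, such that $s_1(f)\le C_1\,s_2(f)$ and $s_2(f)\le C_2\,s_1(f)$ for every $f\in B^{\infty,1}_\alpha$. -/

import Mathlib

open MeasureTheory
open scoped ENNReal NNReal

/-- The surface measure `dx'` on the unit sphere of `ℝⁿ`, normalized by the requirement that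
`r ^ (n - 1) dr dx'` is the Lebesgue measure on the unit ball scaled to total mass one. -/
noncomputable def sphereMeasure (n : ℕ) :
    Measure (Metric.sphere (0 : EuclideanSpace ℝ (Fin n)) 1) :=
  (volume (Metric.ball (0 : EuclideanSpace ℝ (Fin n)) 1))⁻¹ •
    (volume : Measure (EuclideanSpace ℝ (Fin n))).toSphere

/-- The space `h(𝔹)` of (`𝕜`-valued) harmonic functions on the open unit ball of `ℝⁿ`.
Values outside the ball are irrelevant. -/
def harmonicBall (n : ℕ) (𝕜 : Type*) [RCLike 𝕜] : Set (EuclideanSpace ℝ (Fin n) → 𝕜) :=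
  {f | InnerProductSpace.HarmonicOnNhd f (Metric.ball 0 1)}

/-- The integral means `M_q(f, r) = (∫_𝕊 |f(r x')| ^ q dx') ^ (1 / q)`, and the (essential)
supremum over the sphere if `q = ∞`. -/
noncomputable def integralMean {n : ℕ} {𝕜 : Type*} [RCLike 𝕜] (q : ℝ≥0∞)
    (f : EuclideanSpace ℝ (Fin n) → 𝕜) (r : ℝ) : ℝ≥0∞ :=
  eLpNorm (fun x' : Metric.sphere (0 : EuclideanSpace ℝ (Fin n)) 1 =>
    f (r • (x' : EuclideanSpace ℝ (Fin n)))) q (sphereMeasure n)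

/-- The norm `sup_{0 ≤ r < 1} M_q(f, r) (1 - r) ^ α`, with values in `[0, ∞]`. -/
noncomputable def supMixedNorm {n : ℕ} {𝕜 : Type*} [RCLike 𝕜] (q : ℝ≥0∞) (α : ℝ)
    (f : EuclideanSpace ℝ (Fin n) → 𝕜) : ℝ≥0∞ :=
  ⨆ r ∈ Set.Ico (0 : ℝ) 1, integralMean q f r * ENNReal.ofReal ((1 - r) ^ α)

/-- The norm `(∫₀¹ M_q(f, r) ^ p (1 - r) ^ (α p - 1) dr) ^ (1 / p)` for `0 < p < ∞`,
with values in `[0, ∞]`. -/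
noncomputable def mixedNorm {n : ℕ} {𝕜 : Type*} [RCLike 𝕜] (p : ℝ) (q : ℝ≥0∞) (α : ℝ)
    (f : EuclideanSpace ℝ (Fin n) → 𝕜) : ℝ≥0∞ :=
  (∫⁻ r in Set.Ico (0 : ℝ) 1,
    integralMean q f r ^ p * ENNReal.ofReal ((1 - r) ^ (α * p - 1))) ^ (1 / p)

/-- The space `B^{∞,q}_α` of harmonic functions on the unit ball. -/
def supMixedSpace (n : ℕ) (𝕜 : Type*) [RCLike 𝕜] (q : ℝ≥0∞) (α : ℝ) :
    Set (EuclideanSpace ℝ (Fin n) → 𝕜) :=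
  {f | f ∈ harmonicBall n 𝕜 ∧ supMixedNorm q α f < ∞}

/-- The space `B^{p,q}_α`, `0 < p < ∞`, of harmonic functions on the unit ball. -/
def mixedSpace (n : ℕ) (𝕜 : Type*) [RCLike 𝕜] (p : ℝ) (q : ℝ≥0∞) (α : ℝ) :
    Set (EuclideanSpace ℝ (Fin n) → 𝕜) :=
  {f | f ∈ harmonicBall n 𝕜 ∧ mixedNorm p q α f < ∞}

/-- The set `L_{ε,α}(f) = {r ∈ [0, 1) : (1 - r) ^ α ∫_𝕊 |f(r x')| dx' ≥ ε}`. -/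
def levelSet {n : ℕ} {𝕜 : Type*} [RCLike 𝕜] (ε α : ℝ)
    (f : EuclideanSpace ℝ (Fin n) → 𝕜) : Set ℝ :=
  {r | r ∈ Set.Ico (0 : ℝ) 1 ∧
    ENNReal.ofReal ε ≤ ENNReal.ofReal ((1 - r) ^ α) *
      ∫⁻ x' : Metric.sphere (0 : EuclideanSpace ℝ (Fin n)) 1,
        ‖f (r • (x' : EuclideanSpace ℝ (Fin n)))‖ₑ ∂(sphereMeasure n)}

/-- `s₁(f)`, the distance from `f` to `B^{p,1}_α` in the norm of `B^{∞,1}_α`. -/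
noncomputable def distToMixedSpace {n : ℕ} {𝕜 : Type*} [RCLike 𝕜] (p α : ℝ)
    (f : EuclideanSpace ℝ (Fin n) → 𝕜) : ℝ≥0∞ :=
  ⨅ g ∈ mixedSpace n 𝕜 p 1 α, supMixedNorm 1 α (f - g)

/-- `s₂(f)`, the infimum of the `ε > 0` such that `∫_{L_{ε,α}(f)} (1 - r)⁻¹ dr < ∞`. -/
noncomputable def levelThreshold {n : ℕ} {𝕜 : Type*} [RCLike 𝕜] (α : ℝ)
    (f : EuclideanSpace ℝ (Fin n) → 𝕜) : ℝ≥0∞ :=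
  ⨅ (ε : ℝ) (_ : 0 < ε ∧ ∫⁻ r in levelSet ε α f, ENNReal.ofReal ((1 - r)⁻¹) < ∞),
    ENNReal.ofReal ε

/-!
The integral means `M_1(f, r)` of a harmonic function are nondecreasing in `r`
(`integralMean_one_mono`), and this makes both quantities comparable to
`limsup_{r → 1} (1 - r) ^ α M_1(f, r)`; no reproducing kernel is needed.

* If `(1 - r) ^ α M_1(f, r) > 2 ^ α ε` at one radius `r`, then by monotonicity the whole interval
  `[r, (1 + r) / 2]`, whose measure for `dr / (1 - r)` is at least `1 / 2`, lies in `L_{ε,α}(f)`.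
  Hence finite measure of `L_{ε,α}(f)` forces `(1 - r) ^ α M_1(f, r) ≤ 2 ^ α ε` near `1`
  (`exists_integralMean_le_of_levelSet`). In that case the dilations `f (ρ ·)`, which belong to
  `B^{p,1}_α` (`comp_smul_mem_mixedSpace`), come within `2 · 2 ^ α ε` of `f` as `ρ → 1`
  (`exists_supMixedNorm_sub_comp_smul_le`). So `s₁ ≤ 2 ^ (α + 1) s₂`.
* Conversely `s₂ ≤ s₁` is Chebyshev's inequality (`levelThreshold_le_distToMixedSpace`).

Monotonicity is derived from the weak maximum principle alone. The mean of `‖f‖` over a sphere is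
the average of `‖f (U x)‖` over the orthogonal group with its Haar measure
(`exists_lintegral_toSphere_eq`). For fixed `x`, suitable scalars `φ U` of modulus at most one turn
this average into the value at `x` of the superposition of the harmonic functions
`y ↦ Re (φ U * f (U y))`. The superposition is a uniform limit of harmonic functions, so it obeys
the maximum principle, and it is bounded at each `y` by the mean of `‖f‖` over the sphere through
`y` (`integral_norm_rotate_le`).
-/

/-! ### The weak maximum principle and the action of similarities on harmonic functions -/

open Filter Topology InnerProductSpace in
/-- At a local maximum all pure second derivatives of a `C²` function are nonpositive. -/
theorem IsLocalMax.iteratedFDeriv_two_nonpos {E : Type*} [NormedAddCommGroup E] [NormedSpace ℝ E]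
    {v : E → ℝ} {z : E} (hv : ContDiffAt ℝ 2 v z) (hz : IsLocalMax v z) (e : E) :
    iteratedFDeriv ℝ 2 v z ![e, e] ≤ 0 := by
  set γ : ℝ → E := fun t => z + t • e with hγ
  have hγ0 : γ 0 = z := by simp [hγ]
  have hγd : ∀ t, HasDerivAt γ e t := fun t => by
    simpa [hγ] using ((hasDerivAt_id t).smul_const e).const_add z
  have hγt : Tendsto γ (𝓝 0) (𝓝 z) := hγ0 ▸ (hγd 0).continuousAt.tendsto
  have hd1 : deriv (v ∘ γ) =ᶠ[𝓝 0] fun t => fderiv ℝ v (γ t) e := by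
    have h1 : ∀ᶠ y in 𝓝 z, DifferentiableAt ℝ v y :=
      (hv.eventually (by simp)).mono fun y hy => hy.differentiableAt (by norm_num)
    filter_upwards [hγt.eventually h1] with t ht
    exact (ht.hasFDerivAt.comp_hasDerivAt t (hγd t)).deriv
  have hd2 : deriv (deriv (v ∘ γ)) 0 = iteratedFDeriv ℝ 2 v z ![e, e] := by
    rw [hd1.deriv_eq, iteratedFDeriv_two_apply]
    have h2 : DifferentiableAt ℝ (fderiv ℝ v) (γ 0) := by
      rw [hγ0]
      exact (hv.fderiv_right (m := 1) (by norm_num)).differentiableAt (by norm_num)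
    have h3 := h2.hasFDerivAt.comp_hasDerivAt (0 : ℝ) (hγd 0)
    have h4 := (h3.clm_apply (hasDerivAt_const (0 : ℝ) e)).deriv
    simpa [hγ0] using h4
  rw [← hd2]
  by_contra! hpos
  have hmax : IsLocalMax (v ∘ γ) 0 := by
    have := hγt.eventually hz
    simpa only [IsLocalMax, IsMaxFilter, Function.comp, hγ0] using this
  have hcont : ContinuousAt (v ∘ γ) 0 :=
    ContinuousAt.comp (by rw [hγ0]; exact hv.continuousAt) (hγd 0).continuousAt
  have hmin := isLocalMin_of_deriv_deriv_pos hpos hmax.deriv_eq_zero hcont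
  -- a point that is both a local maximum and a local minimum is surrounded by a constant piece
  have hconst : v ∘ γ =ᶠ[𝓝 0] fun _ => (v ∘ γ) 0 := by
    filter_upwards [hmax, hmin] with t h1 h2 using le_antisymm h1 h2
  have : deriv (deriv (v ∘ γ)) 0 = 0 := by
    rw [hconst.deriv.deriv_eq]; simp
  exact hpos.ne' this

open Filter Topology InnerProductSpace in
theorem IsLocalMax.laplacian_nonpos {E : Type*} [NormedAddCommGroup E] [InnerProductSpace ℝ E]
    [FiniteDimensional ℝ E] {v : E → ℝ} {z : E} (hv : ContDiffAt ℝ 2 v z) (hz : IsLocalMax v z) :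
    Laplacian.laplacian v z ≤ 0 := by
  rw [laplacian_eq_iteratedFDeriv_stdOrthonormalBasis]
  exact Finset.sum_nonpos fun i _ => hz.iteratedFDeriv_two_nonpos hv _

open InnerProductSpace in
theorem laplacian_norm_sq {E : Type*} [NormedAddCommGroup E] [InnerProductSpace ℝ E]
    [FiniteDimensional ℝ E] (z : E) :
    Laplacian.laplacian (fun x : E => ‖x‖ ^ 2) z = 2 * Module.finrank ℝ E := by
  rw [laplacian_eq_iteratedFDeriv_stdOrthonormalBasis]
  let B : E →L[ℝ] E →L[ℝ] ℝ := (2 : ℝ) • innerSL ℝ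
  have hB : ∀ x y, B x y = 2 * inner ℝ x y := fun _ _ => rfl
  have h1 : fderiv ℝ (fun x : E => ‖x‖ ^ 2) = B := by
    ext x y
    rw [hB, fderiv_norm_sq_apply]
    simp
  simp only [iteratedFDeriv_two_apply, h1, B.fderiv]
  simp [hB, mul_comm]

open InnerProductSpace Metric in
/-- The weak maximum principle for harmonic functions on a closed ball. -/
theorem InnerProductSpace.HarmonicOnNhd.le_of_le_sphere {E : Type*} [NormedAddCommGroup E]
    [InnerProductSpace ℝ E] [FiniteDimensional ℝ E] [Nontrivial E] {u : E → ℝ} {R M : ℝ}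
    (hu : HarmonicOnNhd u (closedBall 0 R)) (hM : ∀ y ∈ sphere (0 : E) R, u y ≤ M)
    {x : E} (hx : x ∈ closedBall 0 R) : u x ≤ M := by
  -- `u + δ ‖·‖ ^ 2` has positive Laplacian, so it has no local maximum in the open ball
  have key : ∀ δ > 0, u x ≤ M + δ * R ^ 2 := by
    intro δ hδ
    set v : E → ℝ := u + δ • fun x => ‖x‖ ^ 2 with hv
    have hsq : ContDiff ℝ 2 (fun x : E => ‖x‖ ^ 2) := contDiff_norm_sq ℝ
    have hvc : ContinuousOn v (closedBall 0 R) :=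
      hu.continuousOn.add (hsq.continuous.continuousOn.const_smul δ)
    obtain ⟨z, hz, hmax⟩ := (isCompact_closedBall (0 : E) R).exists_isMaxOn ⟨x, hx⟩ hvc
    have hzR : ‖z‖ = R := by
      by_contra hne
      have hlt : z ∈ ball (0 : E) R := by
        rw [mem_ball_zero_iff]
        exact lt_of_le_of_ne (mem_closedBall_zero_iff.1 hz) hne
      have hloc : IsLocalMax v z :=
        hmax.isLocalMax (Filter.mem_of_superset (isOpen_ball.mem_nhds hlt) ball_subset_closedBall)
      have h3 : ContDiffAt ℝ 2 (δ • fun x : E => ‖x‖ ^ 2) z := hsq.contDiffAt.const_smul δ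
      have hle : (Laplacian.laplacian (u + δ • fun x : E => ‖x‖ ^ 2) : E → ℝ) z ≤ 0 :=
        hloc.laplacian_nonpos ((hu z hz).1.add h3)
      rw [(hu z hz).1.laplacian_add h3,
        laplacian_smul δ hsq.contDiffAt, laplacian_norm_sq, (hu z hz).2.self_of_nhds] at hle
      have : (0 : ℝ) < Module.finrank ℝ E := by exact_mod_cast Module.finrank_pos
      simp only [Pi.zero_apply, smul_eq_mul, zero_add] at hle
      have : 0 < δ * (2 * (Module.finrank ℝ E : ℝ)) := by positivity
      linarith
    have h1 : v x ≤ v z := hmax hx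
    have h2 := hM z (mem_sphere_zero_iff_norm.2 hzR)
    simp only [hv, Pi.add_apply, Pi.smul_apply, smul_eq_mul, hzR] at h1
    nlinarith [mul_nonneg hδ.le (sq_nonneg ‖x‖)]
  refine le_of_forall_pos_le_add fun η hη => ?_
  refine (key (η / (R ^ 2 + 1)) (by positivity)).trans ?_
  gcongr
  rw [div_mul_eq_mul_div, div_le_iff₀ (by positivity)]
  nlinarith

open InnerProductSpace in
/-- Harmonicity is preserved by similarities, described here as linear equivalences that map some
orthonormal basis to a multiple of another one. -/
theorem InnerProductSpace.HarmonicAt.comp_similarity {E F ι : Type*} [NormedAddCommGroup E]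
    [InnerProductSpace ℝ E] [FiniteDimensional ℝ E] [NormedAddCommGroup F] [NormedSpace ℝ F]
    [Fintype ι] (L : E ≃L[ℝ] E) (b b' : OrthonormalBasis ι ℝ E) (c : ℝ)
    (hL : ∀ i, L (b i) = c • b' i) {f : E → F} {x : E} (hf : HarmonicAt f (L x)) :
    HarmonicAt (f ∘ L) x := by
  refine ⟨hf.1.comp x L.contDiff.contDiffAt, ?_⟩
  filter_upwards [L.continuous.continuousAt.eventually hf.2] with y hy
  have h1 : ∀ e : E, iteratedFDeriv ℝ 2 (f ∘ L) y ![e, e]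
      = iteratedFDeriv ℝ 2 f (L y) ![L e, L e] := by
    intro e
    have := L.iteratedFDerivWithin_comp_right f uniqueDiffOn_univ (Set.mem_univ (L y)) 2
    rw [Set.preimage_univ, iteratedFDerivWithin_univ, iteratedFDerivWithin_univ] at this
    rw [this, ContinuousMultilinearMap.compContinuousLinearMap_apply]
    congr 1
    ext i
    fin_cases i <;> rfl
  have h2 : ∀ e : E, iteratedFDeriv ℝ 2 f (L y) ![c • e, c • e]
      = (c * c) • iteratedFDeriv ℝ 2 f (L y) ![e, e] := by
    intro e
    simp [iteratedFDeriv_two_apply, smul_smul]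
  rw [laplacian_eq_iteratedFDeriv_orthonormalBasis _ b]
  simp only [h1, hL, h2, ← Finset.smul_sum]
  rw [laplacian_eq_iteratedFDeriv_orthonormalBasis _ b', Pi.zero_apply] at hy
  beta_reduce at hy
  rw [hy, smul_zero, Pi.zero_apply]

open InnerProductSpace in
theorem InnerProductSpace.HarmonicAt.comp_linearIsometryEquiv {E F : Type*} [NormedAddCommGroup E]
    [InnerProductSpace ℝ E] [FiniteDimensional ℝ E] [NormedAddCommGroup F] [NormedSpace ℝ F]
    (U : E ≃ₗᵢ[ℝ] E) {f : E → F} {x : E} (hf : HarmonicAt f (U x)) :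
    HarmonicAt (fun y => f (U y)) x :=
  HarmonicAt.comp_similarity U.toContinuousLinearEquiv (stdOrthonormalBasis ℝ E)
    ((stdOrthonormalBasis ℝ E).map U) 1 (fun i => by simp) hf

open InnerProductSpace in
theorem InnerProductSpace.HarmonicAt.comp_smul_left {E F : Type*} [NormedAddCommGroup E]
    [InnerProductSpace ℝ E] [FiniteDimensional ℝ E] [NormedAddCommGroup F] [NormedSpace ℝ F]
    {c : ℝ} (hc : c ≠ 0) {f : E → F} {x : E} (hf : HarmonicAt f (c • x)) :
    HarmonicAt (fun y => f (c • y)) x :=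
  HarmonicAt.comp_similarity (ContinuousLinearEquiv.smulLeft (Units.mk0 c hc))
    (stdOrthonormalBasis ℝ E) (stdOrthonormalBasis ℝ E) c (fun _ => rfl) hf

/-! ### Averaging over the orthogonal group -/

instance Unitary.instCompactSpace {E : Type*} [NormedAddCommGroup E] [InnerProductSpace ℝ E]
    [FiniteDimensional ℝ E] : CompactSpace (unitary (E →L[ℝ] E)) := by
  apply isCompact_iff_compactSpace.1
  refine Metric.isCompact_of_isClosed_isBounded ?_ ?_
  · have : ((unitary (E →L[ℝ] E) : Submonoid _) : Set (E →L[ℝ] E))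
        = {A | star A * A = 1} ∩ {A | A * star A = 1} := by
      ext A; exact Unitary.mem_iff
    rw [this]
    exact (isClosed_eq (by fun_prop) continuous_const).inter
      (isClosed_eq (by fun_prop) continuous_const)
  · refine isBounded_iff_forall_norm_le.2 ⟨1, fun A hA => ?_⟩
    refine A.opNorm_le_bound zero_le_one fun x => ?_
    rw [one_mul, A.norm_map_of_mem_unitary hA]

/-- The action of the orthogonal group on the unit sphere. -/
noncomputable def sphereRotate {E : Type*} [NormedAddCommGroup E] [InnerProductSpace ℝ E]
    [FiniteDimensional ℝ E] (U : unitary (E →L[ℝ] E)) (x : Metric.sphere (0 : E) 1) :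
    Metric.sphere (0 : E) 1 :=
  ⟨(U : E →L[ℝ] E) x, by
    rw [mem_sphere_zero_iff_norm, Unitary.norm_map, norm_eq_of_mem_sphere]⟩

section
variable {E : Type*} [NormedAddCommGroup E] [InnerProductSpace ℝ E] [FiniteDimensional ℝ E]

theorem continuous_sphereRotate :
    Continuous fun q : unitary (E →L[ℝ] E) × Metric.sphere (0 : E) 1 => sphereRotate q.1 q.2 := by
  unfold sphereRotate
  fun_prop

theorem sphereRotate_mul (U V : unitary (E →L[ℝ] E)) (x : Metric.sphere (0 : E) 1) :
    sphereRotate (U * V) x = sphereRotate U (sphereRotate V x) := rfl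

theorem exists_sphereRotate_eq (x y : Metric.sphere (0 : E) 1) :
    ∃ V : unitary (E →L[ℝ] E), sphereRotate V x = y := by
  refine ⟨Unitary.linearIsometryEquiv.symm (Submodule.reflection (ℝ ∙ ((x : E) - y))ᗮ), ?_⟩
  ext1
  change Submodule.reflection (ℝ ∙ ((x : E) - y))ᗮ (x : E) = y
  exact Submodule.reflection_sub (by simp)

variable [MeasurableSpace E] [BorelSpace E]

open scoped Pointwise in
theorem measurePreserving_sphereRotate (U : unitary (E →L[ℝ] E)) :
    MeasurePreserving (sphereRotate U) (volume : Measure E).toSphere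
      (volume : Measure E).toSphere := by
  have hm : Measurable (sphereRotate U) :=
    (continuous_sphereRotate.comp (Continuous.prodMk_right U)).measurable
  refine ⟨hm, ?_⟩
  ext s hs
  rw [Measure.map_apply hm hs, Measure.toSphere_apply' _ (hm hs), Measure.toSphere_apply' _ hs]
  congr 1
  set Ul := Unitary.linearIsometryEquiv U
  have : Set.Ioo (0 : ℝ) 1 • ((↑) '' (sphereRotate U ⁻¹' s) : Set E)
      = Ul ⁻¹' (Set.Ioo (0 : ℝ) 1 • ((↑) '' s : Set E)) := by
    ext x
    simp only [Set.mem_smul, Set.mem_image, Set.mem_preimage]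
    constructor
    · rintro ⟨t, ht, _, ⟨w, hw, rfl⟩, rfl⟩
      exact ⟨t, ht, _, ⟨_, hw, rfl⟩, (map_smul Ul t (w : E)).symm⟩
    · rintro ⟨t, ht, _, ⟨w, hw, rfl⟩, h⟩
      obtain ⟨w', rfl⟩ : ∃ w', sphereRotate U w' = w := by
        refine ⟨sphereRotate U⁻¹ w, ?_⟩
        rw [← sphereRotate_mul, mul_inv_cancel]
        rfl
      refine ⟨t, ht, _, ⟨w', hw, rfl⟩, Ul.injective ?_⟩
      rw [← h, map_smul]
      rfl
  rw [this, Ul.measurePreserving.measure_preimage_emb Ul.toHomeomorph.measurableEmbedding]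

/-- Integration over the sphere is, up to the total mass, integration over
the orbit of any of its points under the orthogonal group. -/
theorem exists_lintegral_toSphere_eq :
    ∃ μ : Measure (unitary (E →L[ℝ] E)), IsProbabilityMeasure μ ∧
      ∀ h : Metric.sphere (0 : E) 1 → ℝ≥0∞, Measurable h → ∀ e : Metric.sphere (0 : E) 1,
        ∫⁻ x, h x ∂(volume : Measure E).toSphere =
          (volume : Measure E).toSphere Set.univ * ∫⁻ U, h (sphereRotate U e) ∂μ := by
  -- the inversion turns left invariance into right invariance
  set ν : Measure (unitary (E →L[ℝ] E)) := Measure.haarMeasure ⊤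
  have hν : IsProbabilityMeasure ν := ⟨Measure.haarMeasure_self⟩
  refine ⟨ν.inv, Measure.isProbabilityMeasure_map measurable_inv.aemeasurable, fun h hh e => ?_⟩
  have : IsProbabilityMeasure ν.inv :=
    Measure.isProbabilityMeasure_map measurable_inv.aemeasurable
  -- right invariance and transitivity: the orbit average does not depend on the base point
  have hinv : ∀ x, ∫⁻ U, h (sphereRotate U x) ∂ν.inv = ∫⁻ U, h (sphereRotate U e) ∂ν.inv := by
    intro x
    obtain ⟨V, rfl⟩ := exists_sphereRotate_eq e x
    simp_rw [← sphereRotate_mul]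
    exact lintegral_mul_right_eq_self (μ := ν.inv) (fun U => h (sphereRotate U e)) V
  calc ∫⁻ x, h x ∂(volume : Measure E).toSphere
      = ∫⁻ _ : unitary (E →L[ℝ] E), ∫⁻ x, h x ∂(volume : Measure E).toSphere ∂ν.inv := by simp
    _ = ∫⁻ U, ∫⁻ x, h (sphereRotate U x) ∂(volume : Measure E).toSphere ∂ν.inv := by
        simp_rw [fun U => ((measurePreserving_sphereRotate (E := E) U).lintegral_comp hh)]
    _ = ∫⁻ x, ∫⁻ U, h (sphereRotate U x) ∂ν.inv ∂(volume : Measure E).toSphere :=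
        lintegral_lintegral_swap (hh.comp continuous_sphereRotate.measurable).aemeasurable
    _ = _ := by simp_rw [hinv]; rw [lintegral_const, mul_comm]
end

/-! ### Monotonicity of the integral means -/

section
variable {E : Type*} [NormedAddCommGroup E] [InnerProductSpace ℝ E] [FiniteDimensional ℝ E]

open InnerProductSpace Metric in
/-- The maximum principle survives uniform limits of harmonic functions. -/
theorem le_of_mem_closure_harmonic [Nontrivial E] {R C : ℝ} {h : C(closedBall (0 : E) R, ℝ)}
    (hh : h ∈ closure {h : C(closedBall (0 : E) R, ℝ) |
      ∃ F : E → ℝ, HarmonicOnNhd F (closedBall 0 R) ∧ ∀ y, h y = F y})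
    (hC : ∀ y : closedBall (0 : E) R, ‖(y : E)‖ = R → h y ≤ C) (x : closedBall (0 : E) R) :
    h x ≤ C := by
  refine le_of_forall_pos_le_add fun η hη => ?_
  obtain ⟨h', ⟨F, hF, hh'⟩, hd⟩ := Metric.mem_closure_iff.1 hh (η / 2) (by positivity)
  have hclose : ∀ y, |h y - h' y| ≤ η / 2 := fun y =>
    (ContinuousMap.dist_apply_le_dist y).trans hd.le
  have h1 : F x ≤ C + η / 2 := by
    refine hF.le_of_le_sphere (fun y hy => ?_) x.2
    have h2 := hC ⟨y, sphere_subset_closedBall hy⟩ (mem_sphere_zero_iff_norm.1 hy)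
    have h3 := abs_le.1 (hclose ⟨y, sphere_subset_closedBall hy⟩)
    have h4 := hh' ⟨y, sphere_subset_closedBall hy⟩
    dsimp only at h4
    linarith
  have h3 := abs_le.1 (hclose x)
  have h4 := hh' x
  linarith

open InnerProductSpace Metric ComplexConjugate in
/-- The maximum principle for the mean `y ↦ ∫ ‖f (U y)‖ dμ(U)` of a harmonic function over
rotations. Each rotated copy `f ∘ U` is multiplied by a scalar `φ U` of modulus at most one that
turns its value at the given point `x` into `‖f (U x)‖`. The mean at `x` is then the value at `x` of
a superposition of harmonic functions, which obeys the maximum principle and is dominated by the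
mean at every other point. -/
theorem integral_norm_rotate_le [Nontrivial E] {𝕜 : Type*} [RCLike 𝕜] {f : E → 𝕜} {R C : ℝ}
    (hf : HarmonicOnNhd f (closedBall 0 R)) (μ : Measure (unitary (E →L[ℝ] E)))
    [IsProbabilityMeasure μ]
    (hC : ∀ y, ‖y‖ = R → ∫ U, ‖f ((U : E →L[ℝ] E) y)‖ ∂μ ≤ C) {x : E} (hx : ‖x‖ ≤ R) :
    ∫ U, ‖f ((U : E →L[ℝ] E) x)‖ ∂μ ≤ C := by
  have hcont : Continuous fun p : unitary (E →L[ℝ] E) × closedBall (0 : E) R =>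
      f ((p.1 : E →L[ℝ] E) p.2) := by
    refine hf.continuousOn.comp_continuous (by fun_prop) fun p => ?_
    rw [mem_closedBall_zero_iff, Unitary.norm_map]
    exact mem_closedBall_zero_iff.1 p.2.2
  set Ψ : C(unitary (E →L[ℝ] E), C(closedBall (0 : E) R, 𝕜)) := ContinuousMap.curry ⟨_, hcont⟩
  have hΨ : ∀ U y, Ψ U y = f ((U : E →L[ℝ] E) y) := fun _ _ => rfl
  set x' : closedBall (0 : E) R := ⟨x, mem_closedBall_zero_iff.2 hx⟩
  have hΨc : ∀ y, Continuous fun U => Ψ U y := fun y => by fun_prop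
  -- the junk value `0 / 0 = 0` is harmless where `f (U x)` vanishes
  set φ : unitary (E →L[ℝ] E) → 𝕜 := fun U => conj (Ψ U x') / (‖Ψ U x'‖ : 𝕜) with hφ
  have hφm : Measurable φ := by
    have := (hΨc x').measurable
    have h2 : Measurable fun U => (‖Ψ U x'‖ : 𝕜) :=
      (RCLike.continuous_ofReal.comp (hΨc x').norm).measurable
    exact (RCLike.continuous_conj.measurable.comp this).div h2
  have hφ1 : ∀ U, ‖φ U‖ ≤ 1 := fun U => by
    simp only [hφ, norm_div, RCLike.norm_conj, RCLike.norm_ofReal, abs_norm]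
    exact div_self_le_one _
  have hφx : ∀ U, RCLike.re (φ U * Ψ U x') = ‖Ψ U x'‖ := fun U => by
    rcases eq_or_ne (Ψ U x') 0 with h0 | h0
    · simp [h0]
    · have : (‖Ψ U x'‖ : 𝕜) ≠ 0 := by simpa using h0
      rw [hφ]
      dsimp only
      rw [div_mul_eq_mul_div, RCLike.conj_mul, sq, mul_div_assoc, div_self this, mul_one,
        RCLike.ofReal_re]
  have hint1 : Integrable (fun U => φ U • Ψ U) μ := by
    refine Integrable.of_bound (C := ‖Ψ‖)
      (hφm.aestronglyMeasurable.smul Ψ.continuous.aestronglyMeasurable) (.of_forall fun U => ?_)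
    rw [norm_smul]
    exact (mul_le_of_le_one_left (norm_nonneg _) (hφ1 U)).trans (Ψ.norm_coe_le_norm U)
  set T : C(closedBall (0 : E) R, 𝕜) →L[ℝ] C(closedBall (0 : E) R, ℝ) :=
    (RCLike.reCLM : 𝕜 →L[ℝ] ℝ).compLeftContinuous ℝ (closedBall (0 : E) R)
  have hT : ∀ U y, T (φ U • Ψ U) y = RCLike.re (φ U * Ψ U y) := fun _ _ => rfl
  have hint : Integrable (fun U => T (φ U • Ψ U)) μ := T.integrable_comp hint1
  set A : Set C(closedBall (0 : E) R, ℝ) := {h |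
      ∃ F : E → ℝ, HarmonicOnNhd F (closedBall 0 R) ∧ ∀ y, h y = F y} with hA
  have hAc : Convex ℝ A := by
    rintro h ⟨F, hF, hhF⟩ g ⟨H, hH, hgH⟩ a b _ _ _
    exact ⟨a • F + b • H, hF.const_smul.add hH.const_smul, fun y => by simp [hhF, hgH]⟩
  have hmem : ∀ U, T (φ U • Ψ U) ∈ A := by
    intro U
    have h1 : HarmonicOnNhd (fun y => f ((U : E →L[ℝ] E) y)) (closedBall 0 R) := fun y hy =>
      (hf _ (by
        rw [mem_closedBall_zero_iff] at hy ⊢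
        exact (Unitary.norm_map U y).trans_le hy)).comp_linearIsometryEquiv
          (Unitary.linearIsometryEquiv U)
    exact ⟨_, h1.comp_CLM ((RCLike.reCLM : 𝕜 →L[ℝ] ℝ) ∘L (ContinuousLinearMap.mul ℝ 𝕜 (φ U))),
      fun y => rfl⟩
  have hcl := hAc.closure.integral_mem isClosed_closure
    (.of_forall fun U => subset_closure (hmem U)) hint
  have hval : ∀ y, (∫ U, T (φ U • Ψ U) ∂μ) y = ∫ U, RCLike.re (φ U * Ψ U y) ∂μ := fun y => by
    rw [ContinuousMap.integral_apply hint]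
    simp only [hT]
  have hle := le_of_mem_closure_harmonic hcl (C := C) (fun y hy => ?_) x'
  · rw [hval] at hle
    simp only [hφx] at hle
    exact hle
  · rw [hval]
    refine le_trans (integral_mono ?_ ?_ fun U => ?_) (hC y hy)
    · have := (ContinuousMap.evalCLM ℝ y).integrable_comp hint
      exact this
    · exact (hΨc y).norm.integrable_of_hasCompactSupport (.of_compactSpace _)
    · refine (RCLike.re_le_norm _).trans ?_
      rw [norm_mul]
      exact mul_le_of_le_one_left (norm_nonneg _) (hφ1 U)
end

open InnerProductSpace Metric in
/-- The integral means of order one of a harmonic function are nondecreasing in the radius. -/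
theorem integralMean_one_mono {n : ℕ} (hn : 1 ≤ n) {𝕜 : Type*} [RCLike 𝕜]
    {f : EuclideanSpace ℝ (Fin n) → 𝕜} (hf : f ∈ harmonicBall n 𝕜) {r R : ℝ} (hr : 0 ≤ r)
    (hrR : r ≤ R) (hR : R < 1) : integralMean 1 f r ≤ integralMean 1 f R := by
  have : Nonempty (Fin n) := ⟨⟨0, hn⟩⟩
  have hfR : HarmonicOnNhd f (closedBall 0 R) := HarmonicOnNhd.mono hf (closedBall_subset_ball hR)
  obtain ⟨μ, hμ, hμs⟩ := exists_lintegral_toSphere_eq (E := EuclideanSpace ℝ (Fin n))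
  obtain ⟨e, he⟩ := NormedSpace.sphere_nonempty (x := (0 : EuclideanSpace ℝ (Fin n)))
    (r := 1) |>.2 zero_le_one
  have hcont : ∀ y : EuclideanSpace ℝ (Fin n), ‖y‖ ≤ R →
      Continuous fun U : unitary (EuclideanSpace ℝ (Fin n) →L[ℝ] EuclideanSpace ℝ (Fin n)) =>
        f ((U : EuclideanSpace ℝ (Fin n) →L[ℝ] EuclideanSpace ℝ (Fin n)) y) := fun y hy => by
    refine hfR.continuousOn.comp_continuous (by fun_prop) fun U => ?_
    rw [mem_closedBall_zero_iff, Unitary.norm_map]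
    exact hy
  have hint : ∀ y : EuclideanSpace ℝ (Fin n), ‖y‖ ≤ R → Integrable
      (fun U : unitary (EuclideanSpace ℝ (Fin n) →L[ℝ] EuclideanSpace ℝ (Fin n)) =>
        f ((U : EuclideanSpace ℝ (Fin n) →L[ℝ] EuclideanSpace ℝ (Fin n)) y)) μ :=
    fun y hy => (hcont y hy).integrable_of_hasCompactSupport (.of_compactSpace _)
  have key : ∀ t, 0 ≤ t → t ≤ R → ∀ u : sphere (0 : EuclideanSpace ℝ (Fin n)) 1,
      integralMean 1 f t = (volume (ball (0 : EuclideanSpace ℝ (Fin n)) 1))⁻¹ *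
        ((volume : Measure (EuclideanSpace ℝ (Fin n))).toSphere Set.univ *
        ENNReal.ofReal (∫ U, ‖f ((U : EuclideanSpace ℝ (Fin n) →L[ℝ] EuclideanSpace ℝ (Fin n))
          (t • (u : EuclideanSpace ℝ (Fin n))))‖ ∂μ)) := by
    intro t ht htR u
    have hn : ∀ v : sphere (0 : EuclideanSpace ℝ (Fin n)) 1,
        ‖t • (v : EuclideanSpace ℝ (Fin n))‖ ≤ R := fun v => by
      rwa [norm_smul, norm_eq_of_mem_sphere, mul_one, Real.norm_of_nonneg ht]
    have hc : Continuous fun v : sphere (0 : EuclideanSpace ℝ (Fin n)) 1 =>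
        ‖f (t • (v : EuclideanSpace ℝ (Fin n)))‖ₑ :=
      (hfR.continuousOn.comp_continuous (by fun_prop)
        fun v => mem_closedBall_zero_iff.2 (hn v)).enorm
    rw [integralMean, eLpNorm_one_eq_lintegral_enorm, sphereMeasure, lintegral_smul_measure,
      smul_eq_mul, hμs _ hc.measurable u, ofReal_integral_norm_eq_lintegral_enorm (hint _ (hn u))]
    simp only [sphereRotate, map_smul]
  rw [key r hr hrR ⟨e, he⟩, key R (hr.trans hrR) le_rfl ⟨e, he⟩]
  gcongr _ * (_ * ENNReal.ofReal ?_)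
  refine integral_norm_rotate_le hfR μ (fun y hy => ?_) ?_
  · obtain ⟨u, rfl⟩ : ∃ u : sphere (0 : EuclideanSpace ℝ (Fin n)) 1,
        R • (u : EuclideanSpace ℝ (Fin n)) = y := by
      rcases (hr.trans hrR).eq_or_lt with h0 | h0
      · exact ⟨⟨e, he⟩, by rw [← h0, zero_smul, norm_eq_zero.1 (hy.trans h0.symm)]⟩
      · exact ⟨⟨R⁻¹ • y, by
          rw [mem_sphere_zero_iff_norm, norm_smul, hy, norm_inv, Real.norm_of_nonneg h0.le,
            inv_mul_cancel₀ h0.ne']⟩, smul_inv_smul₀ h0.ne' y⟩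
    -- both sides are the mean over the sphere of radius `R`, divided by the same constant
    have h1 := (key R (hr.trans hrR) le_rfl u).symm.trans (key R (hr.trans hrR) le_rfl ⟨e, he⟩)
    rw [ENNReal.mul_right_inj (ENNReal.inv_ne_zero.2 measure_ball_lt_top.ne)
      (ENNReal.inv_ne_top.2 (measure_ball_pos _ _ one_pos).ne'),
      ENNReal.mul_right_inj (Measure.measure_univ_ne_zero.2 (Measure.toSphere_ne_zero _))
      (measure_ne_top _ _)] at h1
    exact ((ENNReal.ofReal_eq_ofReal_iff (integral_nonneg fun _ => norm_nonneg _)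
      (integral_nonneg fun _ => norm_nonneg _)).1 h1).le
  · rwa [norm_smul, mem_sphere_zero_iff_norm.1 he, mul_one, Real.norm_of_nonneg hr]

/-! ### Level sets and approximation by dilations -/

section
variable {n : ℕ} {𝕜 : Type*} [RCLike 𝕜]

instance isFiniteMeasure_sphereMeasure : IsFiniteMeasure (sphereMeasure n) :=
  Measure.smul_finite _ (ENNReal.inv_ne_top.2 (Metric.measure_ball_pos _ _ one_pos).ne')

theorem continuous_sphere_smul {f : EuclideanSpace ℝ (Fin n) → 𝕜} (hf : f ∈ harmonicBall n 𝕜)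
    {r : ℝ} (hr : r ∈ Set.Ico (0 : ℝ) 1) :
    Continuous fun x' : Metric.sphere (0 : EuclideanSpace ℝ (Fin n)) 1 =>
      f (r • (x' : EuclideanSpace ℝ (Fin n))) := by
  refine (InnerProductSpace.HarmonicOnNhd.continuousOn hf).comp_continuous (by fun_prop) fun v => ?_
  rw [mem_ball_zero_iff, norm_smul, norm_eq_of_mem_sphere, mul_one, Real.norm_of_nonneg hr.1]
  exact hr.2

theorem integralMean_one_eq (f : EuclideanSpace ℝ (Fin n) → 𝕜) (r : ℝ) :
    integralMean 1 f r = ∫⁻ x' : Metric.sphere (0 : EuclideanSpace ℝ (Fin n)) 1,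
        ‖f (r • (x' : EuclideanSpace ℝ (Fin n)))‖ₑ ∂(sphereMeasure n) :=
  eLpNorm_one_eq_lintegral_enorm

theorem integralMean_one_lt_top {f : EuclideanSpace ℝ (Fin n) → 𝕜} (hf : f ∈ harmonicBall n 𝕜)
    {r : ℝ} (hr : r ∈ Set.Ico (0 : ℝ) 1) : integralMean 1 f r < ∞ := by
  rw [integralMean_one_eq]
  exact ((continuous_sphere_smul hf hr).integrable_of_hasCompactSupport (.of_compactSpace _)).2

theorem integralMean_one_le_sub_add {f g : EuclideanSpace ℝ (Fin n) → 𝕜}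
    (hf : f ∈ harmonicBall n 𝕜) (hg : g ∈ harmonicBall n 𝕜) {r : ℝ}
    (hr : r ∈ Set.Ico (0 : ℝ) 1) :
    integralMean 1 f r ≤ integralMean 1 (f - g) r + integralMean 1 g r := by
  have h1 := (continuous_sphere_smul hf hr).aestronglyMeasurable (μ := sphereMeasure n)
  have h2 := (continuous_sphere_smul hg hr).aestronglyMeasurable (μ := sphereMeasure n)
  have := eLpNorm_add_le (h1.sub h2) h2 le_rfl
  rwa [sub_add_cancel] at this

theorem integralMean_one_sub_le {f g : EuclideanSpace ℝ (Fin n) → 𝕜}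
    (hf : f ∈ harmonicBall n 𝕜) (hg : g ∈ harmonicBall n 𝕜) {r : ℝ}
    (hr : r ∈ Set.Ico (0 : ℝ) 1) :
    integralMean 1 (f - g) r ≤ integralMean 1 f r + integralMean 1 g r :=
  eLpNorm_sub_le (continuous_sphere_smul hf hr).aestronglyMeasurable
    (continuous_sphere_smul hg hr).aestronglyMeasurable le_rfl

theorem aemeasurable_integralMean_one (hn : 1 ≤ n) {f : EuclideanSpace ℝ (Fin n) → 𝕜}
    (hf : f ∈ harmonicBall n 𝕜) :
    AEMeasurable (integralMean 1 f) (volume.restrict (Set.Ico (0 : ℝ) 1)) :=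
  aemeasurable_restrict_of_monotoneOn measurableSet_Ico fun _ hr _ hs hrs =>
    integralMean_one_mono hn hf hr.1 hrs hs.2

/-- Chebyshev's inequality: wherever `f` is large and `f - g` is small, `g` is large, which a member
of `B^{p,1}_α` can only be on a set of finite measure with respect to `dr / (1 - r)`. -/
theorem levelThreshold_le_distToMixedSpace (hn : 1 ≤ n) {p α : ℝ} (hp : 0 < p)
    {f : EuclideanSpace ℝ (Fin n) → 𝕜} (hf : f ∈ harmonicBall n 𝕜) :
    levelThreshold α f ≤ distToMixedSpace p α f := by
  refine le_iInf₂ fun g hg => ?_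
  obtain ⟨hgh, hgn⟩ := hg
  refine ENNReal.le_of_forall_pos_le_add fun δ hδ hd => ?_
  set d := supMixedNorm 1 α (f - g)
  have hε : ENNReal.ofReal (d.toReal + δ) = d + δ := by
    rw [ENNReal.ofReal_add ENNReal.toReal_nonneg δ.coe_nonneg, ENNReal.ofReal_toReal hd.ne,
      ENNReal.ofReal_coe_nnreal]
  rw [← hε]
  refine iInf₂_le _ ⟨add_pos_of_nonneg_of_pos ENNReal.toReal_nonneg hδ, ?_⟩
  have hsub : levelSet (d.toReal + δ) α f ⊆ Set.Ico 0 1 := fun r hr => hr.1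
  have hlarge : ∀ r ∈ levelSet (d.toReal + δ) α f,
      (δ : ℝ≥0∞) ≤ integralMean 1 g r * ENNReal.ofReal ((1 - r) ^ α) := by
    rintro r ⟨hr, hle⟩
    rw [← integralMean_one_eq, hε, mul_comm] at hle
    have h1 : integralMean 1 (f - g) r * ENNReal.ofReal ((1 - r) ^ α) ≤ d :=
      le_iSup₂ (f := fun r (_ : r ∈ Set.Ico (0 : ℝ) 1) =>
        integralMean 1 (f - g) r * ENNReal.ofReal ((1 - r) ^ α)) r hr
    have h2 : integralMean 1 f r * ENNReal.ofReal ((1 - r) ^ α)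
        ≤ d + integralMean 1 g r * ENNReal.ofReal ((1 - r) ^ α) := by
      refine (mul_le_mul_left (integralMean_one_le_sub_add hf hgh hr) _).trans ?_
      rw [add_mul]
      gcongr
    exact (ENNReal.add_le_add_iff_left hd.ne).1 (hle.trans h2)
  set I : ℝ → ℝ≥0∞ := fun r => integralMean 1 g r ^ p * ENNReal.ofReal ((1 - r) ^ (α * p - 1))
  have hIm : AEMeasurable I (volume.restrict (Set.Ico (0 : ℝ) 1)) := by
    refine ((aemeasurable_integralMean_one hn hgh).pow_const p).mul ?_
    exact Measurable.aemeasurable (by fun_prop)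
  have hI : ∫⁻ r in Set.Ico (0 : ℝ) 1, I r < ∞ := by
    rw [mixedNorm] at hgn
    exact (ENNReal.rpow_lt_top_iff_of_pos (by positivity)).1 hgn
  have hδp : (δ : ℝ≥0∞) ^ p ≠ 0 := by
    simp [ENNReal.rpow_eq_zero_iff, hδ.ne', hp.not_gt]
  have hδt : (δ : ℝ≥0∞) ^ p ≠ ∞ := ENNReal.rpow_ne_top_of_nonneg hp.le ENNReal.coe_ne_top
  calc ∫⁻ r in levelSet (d.toReal + δ) α f, ENNReal.ofReal ((1 - r)⁻¹)
      ≤ ∫⁻ r in levelSet (d.toReal + δ) α f, ((δ : ℝ≥0∞) ^ p)⁻¹ * I r := by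
        refine setLIntegral_mono_ae
          ((hIm.mono_measure (Measure.restrict_mono_set _ hsub)).const_mul _)
          (.of_forall fun r hr => ?_)
        have hr1 : 0 < 1 - r := sub_pos.2 (hsub hr).2
        rw [← ENNReal.div_eq_inv_mul, ENNReal.le_div_iff_mul_le (.inl hδp) (.inl hδt)]
        have h1 := ENNReal.rpow_le_rpow (hlarge r hr) hp.le
        rw [ENNReal.mul_rpow_of_nonneg _ _ hp.le,
          ENNReal.ofReal_rpow_of_nonneg (Real.rpow_nonneg hr1.le _) hp.le,
          ← Real.rpow_mul hr1.le] at h1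
        refine (mul_le_mul_right h1 _).trans (le_of_eq ?_)
        simp only [I]
        rw [mul_left_comm, ← ENNReal.ofReal_mul (by positivity), Real.rpow_sub_one hr1.ne',
          inv_mul_eq_div]
    _ ≤ ∫⁻ r in Set.Ico (0 : ℝ) 1, ((δ : ℝ≥0∞) ^ p)⁻¹ * I r := lintegral_mono_set hsub
    _ = ((δ : ℝ≥0∞) ^ p)⁻¹ * ∫⁻ r in Set.Ico (0 : ℝ) 1, I r :=
        lintegral_const_mul' _ _ (ENNReal.inv_ne_top.2 hδp)
    _ < ∞ := ENNReal.mul_lt_top (ENNReal.inv_ne_top.2 hδp).lt_top hI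

/-- If the level set `L_{ε,α}(f)` has finite measure with respect to `dr / (1 - r)`, then
`(1 - r) ^ α M_1(f, r)` is eventually at most `2 ^ α ε`: by monotonicity of `M_1(f, ·)`, a larger
value at `r` puts the whole interval `[r, (1 + r) / 2]` into `L_{ε,α}(f)`, and this interval has
measure at least `1 / 2`. -/
theorem exists_integralMean_le_of_levelSet (hn : 1 ≤ n) {ε α : ℝ} (hα : 0 < α)
    {f : EuclideanSpace ℝ (Fin n) → 𝕜} (hf : f ∈ harmonicBall n 𝕜)
    (hL : ∫⁻ r in levelSet ε α f, ENNReal.ofReal ((1 - r)⁻¹) < ∞) :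
    ∃ R ∈ Set.Ico (0 : ℝ) 1, ∀ r ∈ Set.Ico R 1,
      integralMean 1 f r * ENNReal.ofReal ((1 - r) ^ α) ≤ ENNReal.ofReal (2 ^ α * ε) := by
  obtain ⟨δ, hδ, hsmall⟩ := exists_pos_setLIntegral_lt_of_measure_lt hL.ne
    (ε := ENNReal.ofReal (1 / 2)) (by simp)
  obtain ⟨a, ha0, haδ⟩ := ENNReal.lt_iff_exists_nnreal_btwn.1 hδ
  have ha0' : (0 : ℝ) < a := by exact_mod_cast ha0
  refine ⟨max 0 (1 - a), ⟨le_max_left _ _, max_lt one_pos (by linarith)⟩, fun r hr => ?_⟩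
  have hr0 : 0 ≤ r := (le_max_left _ _).trans hr.1
  have hra : 1 - a ≤ r := (le_max_right _ _).trans hr.1
  have hr1 : 0 < 1 - r := sub_pos.2 hr.2
  by_contra! hlt
  have h2 : ENNReal.ofReal ((2 : ℝ) ^ α) ≠ 0 := by simp; positivity
  have hIL : Set.Icc r ((1 + r) / 2) ⊆ levelSet ε α f := by
    intro s hs
    have hs1 : s < 1 := by linarith [hs.2]
    refine ⟨⟨hr0.trans hs.1, hs1⟩, ?_⟩
    rw [← integralMean_one_eq, ← ENNReal.mul_le_mul_iff_right h2 ENNReal.ofReal_ne_top,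
      ← ENNReal.ofReal_mul (by positivity), ← mul_assoc, ← ENNReal.ofReal_mul (by positivity),
      mul_comm (ENNReal.ofReal _)]
    refine hlt.le.trans (mul_le_mul' (integralMean_one_mono hn hf hr0 hs.1 hs1) ?_)
    rw [← Real.mul_rpow zero_le_two (by linarith)]
    exact ENNReal.ofReal_le_ofReal (Real.rpow_le_rpow hr1.le (by linarith [hs.2]) hα.le)
  have hvol : volume (Set.Icc r ((1 + r) / 2)) = ENNReal.ofReal ((1 - r) / 2) := by
    rw [Real.volume_Icc]
    ring_nf
  have h3 := hsmall (Set.Icc r ((1 + r) / 2)) <| calc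
    _ ≤ volume (Set.Icc r ((1 + r) / 2)) := Measure.restrict_apply_le _ _
    _ ≤ ENNReal.ofReal a := by
        rw [hvol]
        exact ENNReal.ofReal_le_ofReal (by linarith)
    _ < δ := by rwa [ENNReal.ofReal_coe_nnreal]
  rw [Measure.restrict_restrict measurableSet_Icc, Set.inter_eq_left.2 hIL] at h3
  refine h3.not_ge ?_
  calc ENNReal.ofReal (1 / 2)
      = ∫⁻ _ in Set.Icc r ((1 + r) / 2), ENNReal.ofReal ((1 - r)⁻¹) := by
        rw [setLIntegral_const, hvol, ← ENNReal.ofReal_mul (by positivity)]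
        congr 1
        field_simp
    _ ≤ _ := setLIntegral_mono' measurableSet_Icc fun s hs =>
        ENNReal.ofReal_le_ofReal (inv_anti₀ (by linarith [hs.2]) (by linarith [hs.1]))

theorem integralMean_comp_smul (f : EuclideanSpace ℝ (Fin n) → 𝕜) (ρ r : ℝ) :
    integralMean 1 (fun x => f (ρ • x)) r = integralMean 1 f (ρ * r) := by
  simp only [integralMean, smul_smul]

theorem comp_smul_mem_harmonicBall {f : EuclideanSpace ℝ (Fin n) → 𝕜}
    (hf : f ∈ harmonicBall n 𝕜) {ρ : ℝ} (hρ : ρ ∈ Set.Ioo (0 : ℝ) 1) :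
    (fun x => f (ρ • x)) ∈ harmonicBall n 𝕜 := fun x hx =>
  InnerProductSpace.HarmonicAt.comp_smul_left hρ.1.ne' <| hf _ <| by
    rw [mem_ball_zero_iff] at hx ⊢
    rw [norm_smul, Real.norm_of_nonneg hρ.1.le]
    exact (mul_le_of_le_one_left (norm_nonneg _) hρ.2.le).trans_lt hx

/-- The dilations `x ↦ f (ρ x)`, `0 < ρ < 1`, of a harmonic function have bounded integral means,
hence belong to all spaces `B^{p,1}_α`. -/
theorem comp_smul_mem_mixedSpace (hn : 1 ≤ n) {p α : ℝ} (hp : 0 < p) (hα : 0 < α)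
    {f : EuclideanSpace ℝ (Fin n) → 𝕜} (hf : f ∈ harmonicBall n 𝕜) {ρ : ℝ}
    (hρ : ρ ∈ Set.Ioo (0 : ℝ) 1) : (fun x => f (ρ • x)) ∈ mixedSpace n 𝕜 p 1 α := by
  refine ⟨comp_smul_mem_harmonicBall hf hρ, ?_⟩
  rw [mixedNorm, ENNReal.rpow_lt_top_iff_of_pos (by positivity)]
  have hint : IntegrableOn (fun r : ℝ => (1 - r) ^ (α * p - 1)) (Set.Ico 0 1) := by
    have h1 := ((intervalIntegral.intervalIntegrable_rpow' (a := 0) (b := 1) (r := α * p - 1)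
      (by nlinarith [mul_pos hα hp])).comp_sub_left 1).symm
    rw [sub_zero, sub_self, intervalIntegrable_iff_integrableOn_Ico_of_le zero_le_one] at h1
    exact h1
  calc ∫⁻ r in Set.Ico (0 : ℝ) 1, integralMean 1 (fun x => f (ρ • x)) r ^ p *
        ENNReal.ofReal ((1 - r) ^ (α * p - 1))
      ≤ ∫⁻ r in Set.Ico (0 : ℝ) 1, integralMean 1 f ρ ^ p *
        ENNReal.ofReal ((1 - r) ^ (α * p - 1)) := by
        refine setLIntegral_mono' measurableSet_Ico fun r hr => ?_
        rw [integralMean_comp_smul]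
        gcongr
        exact integralMean_one_mono hn hf (mul_nonneg hρ.1.le hr.1)
          (mul_le_of_le_one_right hρ.1.le hr.2.le) hρ.2
    _ = integralMean 1 f ρ ^ p *
        ∫⁻ r in Set.Ico (0 : ℝ) 1, ENNReal.ofReal ((1 - r) ^ (α * p - 1)) :=
        lintegral_const_mul _ (by fun_prop)
    _ < ∞ := by
        refine ENNReal.mul_lt_top (ENNReal.rpow_lt_top_of_nonneg hp.le
          (integralMean_one_lt_top hf ⟨hρ.1.le, hρ.2⟩).ne) ?_
        refine lt_of_le_of_lt (lintegral_mono fun r => ?_) hint.2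
        exact Real.ofReal_le_enorm _

/-- If `(1 - r) ^ α M_1(f, r)` is at most `a` near the boundary, then dilations of `f` approximate
`f` up to `2 a`. Near the boundary this is the triangle inequality and monotonicity of the integral
means, and on a smaller ball the dilations converge uniformly to `f`. -/
theorem exists_supMixedNorm_sub_comp_smul_le (hn : 1 ≤ n) {a R α : ℝ} (hα : 0 < α) (ha : 0 < a)
    (hR : R ∈ Set.Ico (0 : ℝ) 1) {f : EuclideanSpace ℝ (Fin n) → 𝕜} (hf : f ∈ harmonicBall n 𝕜)
    (hfa : ∀ r ∈ Set.Ico R 1,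
      integralMean 1 f r * ENNReal.ofReal ((1 - r) ^ α) ≤ ENNReal.ofReal a) :
    ∃ ρ ∈ Set.Ioo (0 : ℝ) 1,
      supMixedNorm 1 α (f - fun x => f (ρ • x)) ≤ 2 * ENNReal.ofReal a := by
  have huc := (isCompact_closedBall (0 : EuclideanSpace ℝ (Fin n))
    R).uniformContinuousOn_of_continuous
      ((InnerProductSpace.HarmonicOnNhd.continuousOn hf).mono
        (Metric.closedBall_subset_ball hR.2))
  set m : ℝ := (sphereMeasure n).real Set.univ
  have hm : 0 ≤ m := measureReal_nonneg
  obtain ⟨δ, hδ, hfδ⟩ := Metric.uniformContinuousOn_iff_le.1 huc (a / (m + 1)) (by positivity)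
  have hρ : max (1 / 2) (1 - δ) ∈ Set.Ioo (0 : ℝ) 1 :=
    ⟨lt_max_of_lt_left (by norm_num), max_lt (by norm_num) (by linarith)⟩
  have hρδ : 1 - δ ≤ max (1 / 2) (1 - δ) := le_max_right _ _
  set ρ := max (1 / 2) (1 - δ)
  refine ⟨ρ, hρ, iSup₂_le fun r hr => ?_⟩
  have hr1 : 0 < 1 - r := sub_pos.2 hr.2
  rcases le_total R r with hRr | hrR
  · have h1 : integralMean 1 (fun x => f (ρ • x)) r ≤ integralMean 1 f r := by
      rw [integralMean_comp_smul]
      exact integralMean_one_mono hn hf (mul_nonneg hρ.1.le hr.1)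
        (mul_le_of_le_one_left hr.1 hρ.2.le) hr.2
    calc _ ≤ (2 * integralMean 1 f r) * ENNReal.ofReal ((1 - r) ^ α) := by
          rw [two_mul]
          gcongr
          exact (integralMean_one_sub_le hf (comp_smul_mem_harmonicBall hf hρ) hr).trans
            (by gcongr)
      _ ≤ _ := by
          rw [mul_assoc]
          gcongr
          exact hfa r ⟨hRr, hr.2⟩
  · have h1 : integralMean 1 (f - fun x => f (ρ • x)) r ≤ ENNReal.ofReal a := by
      rw [integralMean_one_eq]
      calc _ ≤ ∫⁻ _ : Metric.sphere (0 : EuclideanSpace ℝ (Fin n)) 1,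
            ENNReal.ofReal (a / (m + 1)) ∂(sphereMeasure n) := by
            refine lintegral_mono fun x => ?_
            rw [← ofReal_norm, Pi.sub_apply, ← dist_eq_norm]
            have hx : ‖r • (x : EuclideanSpace ℝ (Fin n))‖ = r := by
              rw [norm_smul, norm_eq_of_mem_sphere, mul_one, Real.norm_of_nonneg hr.1]
            refine ENNReal.ofReal_le_ofReal (hfδ _ ?_ _ ?_ ?_)
            · rwa [mem_closedBall_zero_iff, hx]
            · rw [mem_closedBall_zero_iff, norm_smul, hx, Real.norm_of_nonneg hρ.1.le]
              exact (mul_le_of_le_one_left hr.1 hρ.2.le).trans hrR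
            · rw [dist_eq_norm, ← one_smul ℝ (r • (x : EuclideanSpace ℝ (Fin n))), smul_smul ρ,
                mul_one, ← sub_smul, norm_smul, hx, Real.norm_of_nonneg (sub_nonneg.2 hρ.2.le)]
              exact (mul_le_of_le_one_right (sub_nonneg.2 hρ.2.le) hr.2.le).trans (by linarith)
        _ = ENNReal.ofReal (a / (m + 1) * m) := by
            rw [lintegral_const, ENNReal.ofReal_mul (by positivity), ofReal_measureReal]
        _ ≤ ENNReal.ofReal a := by
            refine ENNReal.ofReal_le_ofReal ?_
            rw [div_mul_eq_mul_div, div_le_iff₀ (by positivity)]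
            nlinarith
    calc _ ≤ ENNReal.ofReal a * 1 := by
          gcongr
          exact ENNReal.ofReal_le_one.2 (Real.rpow_le_one hr1.le (by linarith [hr.1]) hα.le)
      _ ≤ _ := by
          rw [mul_one]
          exact le_mul_of_one_le_left' one_le_two

theorem distToMixedSpace_le_levelThreshold (hn : 1 ≤ n) {p α : ℝ} (hp : 0 < p) (hα : 0 < α)
    {f : EuclideanSpace ℝ (Fin n) → 𝕜} (hf : f ∈ harmonicBall n 𝕜) :
    distToMixedSpace p α f ≤ ENNReal.ofReal (2 * 2 ^ α) * levelThreshold α f := by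
  have hC : ENNReal.ofReal (2 * 2 ^ α) ≠ 0 := by simp; positivity
  rw [mul_comm, ← ENNReal.div_le_iff hC ENNReal.ofReal_ne_top]
  refine le_iInf₂ fun ε hε => ?_
  rw [ENNReal.div_le_iff hC ENNReal.ofReal_ne_top, mul_comm]
  obtain ⟨R, hR, hfR⟩ := exists_integralMean_le_of_levelSet hn hα hf hε.2
  obtain ⟨ρ, hρ, hfρ⟩ := exists_supMixedNorm_sub_comp_smul_le hn hα
    (mul_pos (by positivity) hε.1) hR hf hfR
  refine (iInf₂_le _ (comp_smul_mem_mixedSpace hn hp hα hf hρ)).trans (hfρ.trans_eq ?_)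
  rw [← ENNReal.ofReal_mul (by positivity), mul_assoc, ENNReal.ofReal_mul zero_le_two,
    ENNReal.ofReal_ofNat]
end

theorem theorem3 (n : ℕ) (hn : 1 ≤ n) (p : ℝ) (hp : 1 ≤ p) (α : ℝ) (hα : 0 < α) :
    ∃ C₁ C₂ : ℝ≥0, ∀ (𝕜 : Type*) [RCLike 𝕜] (f : EuclideanSpace ℝ (Fin n) → 𝕜),
      f ∈ supMixedSpace n 𝕜 1 α →
        distToMixedSpace p α f ≤ C₁ * levelThreshold α f ∧
          levelThreshold α f ≤ C₂ * distToMixedSpace p α f := by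
  have hp0 : 0 < p := one_pos.trans_le hp
  refine ⟨(2 * 2 ^ α : ℝ).toNNReal, 1, fun 𝕜 _ f hf => ⟨?_, ?_⟩⟩
  · exact distToMixedSpace_le_levelThreshold hn hp0 hα hf.1
  · rw [ENNReal.coe_one, one_mul]
    exact levelThreshold_le_distToMixedSpace hn hp0 hf.1
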